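/- For a squarefree integer $d$ (possibly negative), let $H^d$ be the smooth projective genus one curve over $\mathbb{Q}$ with affine equation $$H^d:\quad d y^2=(x^2-x-3)(x^2+2x-12),$$ that is, the curve $dY^2=(X^2-XZ-3Z^2)(X^2+2XZ-12Z^2)$ in the weighted projective plane $\mathbb{P}(1,2,1)$ with coordinates $(X:Y:Z)$. If $H^d(\mathbb{Q})\neq\emptyset$, then $H^d(\mathbb{Q})$ is infinite. -/

import Mathlib

namespace QuarticTwist

/-- The binary quartic form `F(X, Z) = (X² - XZ - 3Z²)(X² + 2XZ - 12Z²)`, the homogenization of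
`f(x) = (x² - x - 3)(x² + 2x - 12)`. -/
def quarticForm (X Z : ℚ) : ℚ :=
  (X ^ 2 - X * Z - 3 * Z ^ 2) * (X ^ 2 + 2 * X * Z - 12 * Z ^ 2)

/-- Rational weighted homogeneous coordinates `(X, Y, Z)`, of weights `1, 2, 1`, of a point of the
curve `d Y² = F(X, Z)`. For `d ≠ 0` the equation rules out `X = Z = 0` except for the excluded
triple `(0, 0, 0)`. -/
structure Coords (d : ℤ) where
  X : ℚ
  Y : ℚ
  Z : ℚ
  ne_zero : X ≠ 0 ∨ Z ≠ 0
  equation : (d : ℚ) * Y ^ 2 = quarticForm X Z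

/-- Two coordinate triples give the same point when they differ by the weighted scaling
`(X, Y, Z) ↦ (c X, c² Y, c Z)` with `c ∈ ℚˣ`. -/
def coordsSetoid (d : ℤ) : Setoid (Coords d) where
  r P Q := ∃ c : ℚ, c ≠ 0 ∧ Q.X = c * P.X ∧ Q.Y = c ^ 2 * P.Y ∧ Q.Z = c * P.Z
  iseqv :=
    { refl := fun P => ⟨1, one_ne_zero, by ring, by ring, by ring⟩
      symm := by
        rintro P Q ⟨c, hc, hX, hY, hZ⟩
        refine ⟨c⁻¹, inv_ne_zero hc, ?_, ?_, ?_⟩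
        · rw [hX]; field_simp
        · rw [hY]; field_simp
        · rw [hZ]; field_simp
      trans := by
        rintro P Q R ⟨c, hc, hX, hY, hZ⟩ ⟨e, he, hX', hY', hZ'⟩
        refine ⟨e * c, mul_ne_zero he hc, ?_, ?_, ?_⟩
        · rw [hX', hX]; ring
        · rw [hY', hY]; ring
        · rw [hZ', hZ]; ring }

/-- The set `H^d(ℚ)` of rational points of the smooth projective genus one curve
`H^d : d y² = (x² - x - 3)(x² + 2x - 12)`, embedded in the weighted projective plane `ℙ(1, 2, 1)`.
The points with `Z ≠ 0` are the affine solutions `(x, y) = (X / Z, Y / Z²)`; the points at infinity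
are `(1 : t : 0)` with `d t² = 1`. -/
def RationalPoint (d : ℤ) : Type :=
  Quotient (coordsSetoid d)

end QuarticTwist

open WeierstrassCurve

/-! The curve H^d is a two-covering of its Jacobian E^d, and its rational points lie over exactly
the abscissae in the square classes (1, 13, 13). A point Q in these classes has infinite order: odd
multiples of Q stay in them (`InClass.odd_nsmul`), so are not 2-torsion, and a nonzero double is
never 2-torsion (`InClass.add_self_ne_zero`), so repeated doubling never reaches 0. The odd
multiples give infinitely many abscissae, each of which lifts to H^d. -/

/-- Evaluating at a root `e` of the cubic the polynomial that cuts out the intersection of a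
short-form Weierstrass curve with the line through two of its points. -/
theorem WeierstrassCurve.Affine.addX_sub_mul_sub_mul_sub {F : Type*} [Field F] [DecidableEq F]
    {W : Affine F} (ha₁ : W.a₁ = 0) (ha₃ : W.a₃ = 0) {e x₁ x₂ y₁ y₂ : F} (he : W.Equation e 0)
    (h₁ : W.Equation x₁ y₁) (h₂ : W.Equation x₂ y₂) (hxy : ¬(x₁ = x₂ ∧ y₁ = W.negY x₂ y₂)) :
    (W.addX x₁ x₂ (W.slope x₁ x₂ y₁ y₂) - e) * (x₁ - e) * (x₂ - e) =
      (W.slope x₁ x₂ y₁ y₂ * (e - x₁) + y₁) ^ 2 := by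
  have h := congr_arg (Polynomial.eval e) (Affine.addPolynomial_slope h₁ h₂ hxy)
  rw [Affine.equation_iff, ha₁, ha₃] at he
  rw [Affine.addPolynomial_eq] at h
  simp only [Cubic.toPoly, ha₁, ha₃, Polynomial.eval_neg, Polynomial.eval_add, Polynomial.eval_mul,
    Polynomial.eval_C, Polynomial.eval_pow, Polynomial.eval_X, Polynomial.eval_sub] at h
  linear_combination he - h

theorem eq_zero_of_sq_eq_natCast_mul_sq {n : ℕ} (hn : ¬ IsSquare n) {u v : ℚ}
    (h : u ^ 2 = n * v ^ 2) : v = 0 := by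
  by_contra hv
  refine hn (Rat.isSquare_natCast_iff.mp ⟨u / v, ?_⟩)
  field_simp
  exact h.symm

namespace QuarticTwist

/-! ### Square classes on the Jacobian -/

/-- The Jacobian `y² = (x + 9d)(x + 13d)(x + 117d)` of the curve `H^d`. -/
def jacobian (d : ℚ) : Affine ℚ :=
  ⟨0, 139 * d, 0, 2691 * d ^ 2, 13689 * d ^ 3⟩

theorem jacobian_equation_iff {d x y : ℚ} :
    (jacobian d).Equation x y ↔ y ^ 2 = (x + 9 * d) * (x + 13 * d) * (x + 117 * d) := by
  rw [Affine.equation_iff]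
  simp only [jacobian]
  constructor <;> intro h <;> linear_combination h

theorem jacobian_negY {d x y : ℚ} : (jacobian d).negY x y = -y := by
  simp [Affine.negY, jacobian]

theorem jacobian_nonsingular {d x y : ℚ} (h : (jacobian d).Equation x y) (hy : y ≠ 0) :
    (jacobian d).Nonsingular x y := by
  rw [Affine.nonsingular_iff]
  refine ⟨h, Or.inr fun h' => hy ?_⟩
  simp only [jacobian] at h'
  linarith

/-- `x + 9d`, `x + 13d`, `x + 117d` lie in the square classes of `1`, `a`, `a`. -/
def HasClass (d a x : ℚ) : Prop :=
  ∃ r s t : ℚ, x + 9 * d = r ^ 2 ∧ x + 13 * d = a * s ^ 2 ∧ x + 117 * d = a * t ^ 2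

/-- A nonzero point of the Jacobian whose abscissa is in the square classes `(1, a, a)`. -/
def InClass (d a : ℚ) (P : (jacobian d).Point) : Prop :=
  ∃ x y, ∃ h : (jacobian d).Nonsingular x y, P = .some x y h ∧ HasClass d a x

/-- At a 2-torsion abscissa the other two factors are multiples of d. Their ratio would make 27, 702
or 54 a square, or they have opposite signs at -13d. -/
theorem HasClass.ne_roots {d a x : ℚ} (hd : d ≠ 0) (ha : a = 1 ∨ a = 13) (h : HasClass d a x) :
    x + 9 * d ≠ 0 ∧ x + 13 * d ≠ 0 ∧ x + 117 * d ≠ 0 := by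
  obtain ⟨r, s, t, hr, hs, ht⟩ := h
  have ha0 : 0 < a := by rcases ha with rfl | rfl <;> norm_num
  refine ⟨fun h0 => hd ?_, fun h0 => hd ?_, fun h0 => hd ?_⟩
  · have key : t ^ 2 = (27 : ℕ) * s ^ 2 := by
      refine mul_left_cancel₀ ha0.ne' ?_
      push_cast
      linear_combination 27 * hs - ht - 26 * h0
    have := eq_zero_of_sq_eq_natCast_mul_sq (by norm_num) key
    subst this
    linarith
  · have h1 : 0 ≤ a * t ^ 2 := by positivity
    have h2 : 0 ≤ r ^ 2 := by positivity
    linarith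
  · have hs0 : s = 0 := by
      rcases ha with rfl | rfl
      · refine eq_zero_of_sq_eq_natCast_mul_sq (n := 702) (u := 26 * r) (by norm_num) ?_
        push_cast
        linear_combination -676 * hr + 702 * hs - 26 * h0
      · refine eq_zero_of_sq_eq_natCast_mul_sq (n := 54) (u := 2 * r) (by norm_num) ?_
        push_cast
        linear_combination -4 * hr + 54 / 13 * hs - 2 / 13 * h0
    subst hs0
    linarith

theorem eq_mul_sq_of_mul_mul_eq_sq {u v w ℓ a s r : ℚ} (h : u * v * w = ℓ ^ 2)
    (hv : v = a * s ^ 2) (hv0 : v ≠ 0) (hw : w = r ^ 2) (hw0 : w ≠ 0) :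
    u = a * (ℓ / (a * s * r)) ^ 2 := by
  subst hv hw
  have ha : a ≠ 0 := left_ne_zero_of_mul hv0
  have hs : s ≠ 0 := by rintro rfl; simp at hv0
  have hr : r ≠ 0 := by rintro rfl; simp at hw0
  field_simp
  linear_combination h

/-- This makes x + cd multiplicative modulo squares: the Kummer map at the 2-torsion point (-cd, 0).
-/
theorem add_kummer {d x₁ x₂ y₁ y₂ c : ℚ} (hc : c = 9 ∨ c = 13 ∨ c = 117)
    (h₁ : (jacobian d).Equation x₁ y₁) (h₂ : (jacobian d).Equation x₂ y₂)
    (hxy : ¬(x₁ = x₂ ∧ y₁ = (jacobian d).negY x₂ y₂)) :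
    ((jacobian d).addX x₁ x₂ ((jacobian d).slope x₁ x₂ y₁ y₂) + c * d) * (x₁ + c * d) *
      (x₂ + c * d) = ((jacobian d).slope x₁ x₂ y₁ y₂ * (-(c * d) - x₁) + y₁) ^ 2 := by
  have he : (jacobian d).Equation (-(c * d)) 0 := by
    rw [jacobian_equation_iff]
    rcases hc with rfl | rfl | rfl <;> ring
  have := Affine.addX_sub_mul_sub_mul_sub rfl rfl he h₁ h₂ hxy
  simpa only [sub_neg_eq_add] using this

/-- A nonzero double has trivial square classes. -/
theorem inClass_add_self {d : ℚ} {P : (jacobian d).Point} (hP : P + P ≠ 0) :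
    InClass d 1 (P + P) := by
  rcases P with _ | ⟨x, y, h⟩
  · exact absurd (add_zero _) hP
  have hy : y ≠ (jacobian d).negY x y := fun hy => hP (Affine.Point.add_self_of_Y_eq hy)
  have hxy : ¬(x = x ∧ y = (jacobian d).negY x y) := fun hxy => hy hxy.2
  have hy0 : y ≠ 0 := by
    rintro rfl
    exact hy (by rw [jacobian_negY, neg_zero])
  have hprod : (x + 9 * d) * (x + 13 * d) * (x + 117 * d) ≠ 0 := by
    rw [← jacobian_equation_iff.mp h.1]
    exact pow_ne_zero 2 hy0
  have hsq : ∀ c : ℚ, (c = 9 ∨ c = 13 ∨ c = 117) → x + c * d ≠ 0 → ∃ r : ℚ,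
      (jacobian d).addX x x ((jacobian d).slope x x y y) + c * d = r ^ 2 := by
    intro c hc hne
    refine ⟨((jacobian d).slope x x y y * (-(c * d) - x) + y) / (x + c * d), ?_⟩
    rw [div_pow, ← add_kummer hc h.1 h.1 hxy]
    field_simp
  obtain ⟨r, hr⟩ := hsq 9 (by simp) (left_ne_zero_of_mul (left_ne_zero_of_mul hprod))
  obtain ⟨s, hs⟩ := hsq 13 (by simp) (right_ne_zero_of_mul (left_ne_zero_of_mul hprod))
  obtain ⟨t, ht⟩ := hsq 117 (by simp) (right_ne_zero_of_mul hprod)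
  exact ⟨_, _, _, Affine.Point.add_some hxy, r, s, t, hr, by rw [one_mul, hs], by rw [one_mul, ht]⟩

theorem InClass.add_self_ne_zero {d a : ℚ} (hd : d ≠ 0) (ha : a = 1 ∨ a = 13)
    {P : (jacobian d).Point} (hP : InClass d a P) : P + P ≠ 0 := by
  obtain ⟨x, y, h, rfl, hx⟩ := hP
  obtain ⟨h9, h13, h117⟩ := hx.ne_roots hd ha
  have hy : y ≠ (jacobian d).negY x y := by
    rw [jacobian_negY]
    intro hy
    have hy0 : y = 0 := by linarith
    have := jacobian_equation_iff.mp h.1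
    rw [hy0] at this
    exact mul_ne_zero (mul_ne_zero h9 h13) h117 (by rw [← this]; ring)
  rw [Affine.Point.add_some fun hxy => hy hxy.2]
  exact Affine.Point.some_ne_zero _

/-- The points in the square classes `(1, 13, 13)` are stable under translation by doubles. -/
theorem InClass.add_double {d : ℚ} (hd : d ≠ 0) {Q : (jacobian d).Point} (hQ : InClass d 13 Q)
    (R : (jacobian d).Point) : InClass d 13 (Q + (R + R)) := by
  by_cases hR : R + R = 0
  · rwa [hR, add_zero]
  obtain ⟨x₁, y₁, h₁, rfl, hx₁⟩ := hQ
  obtain ⟨x₂, y₂, h₂, hRR, hx₂⟩ := inClass_add_self hR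
  rw [hRR]
  obtain ⟨h9, h13, h117⟩ := hx₁.ne_roots hd (Or.inr rfl)
  obtain ⟨k9, k13, k117⟩ := hx₂.ne_roots hd (Or.inl rfl)
  obtain ⟨r, s, t, hr, hs, ht⟩ := hx₁
  obtain ⟨r', s', t', hr', hs', ht'⟩ := hx₂
  rw [one_mul] at hs' ht'
  have hxy : ¬(x₁ = x₂ ∧ y₁ = (jacobian d).negY x₂ y₂) := by
    rintro ⟨hx, -⟩
    -- Equal abscissae would make 13 a square.
    have : s = 0 := by
      refine eq_zero_of_sq_eq_natCast_mul_sq (n := 13) (u := s') (by norm_num) ?_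
      push_cast
      rw [← hs', ← hs, hx]
    exact h13 (by rw [hs, this]; ring)
  have l9 := eq_mul_sq_of_mul_mul_eq_sq (add_kummer (c := 9) (by simp) h₁.1 h₂.1 hxy)
    (hr.trans (one_mul _).symm) h9 hr' k9
  have l13 := eq_mul_sq_of_mul_mul_eq_sq (add_kummer (c := 13) (by simp) h₁.1 h₂.1 hxy)
    hs h13 hs' k13
  have l117 := eq_mul_sq_of_mul_mul_eq_sq (add_kummer (c := 117) (by simp) h₁.1 h₂.1 hxy)
    ht h117 ht' k117
  rw [one_mul] at l9
  exact ⟨_, _, _, Affine.Point.add_some hxy, _, _, _, l9, l13, l117⟩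

/-! ### Infinite order -/

/-- There is no rational point of exact order `4`, so iterated doubles do not vanish. -/
theorem two_pow_nsmul_ne_zero {d : ℚ} (hd : d ≠ 0) (k : ℕ) {P : (jacobian d).Point}
    (hP : P + P ≠ 0) : 2 ^ k • P ≠ 0 := by
  induction k generalizing P with
  | zero =>
    rw [pow_zero, one_nsmul]
    rintro rfl
    exact hP (add_zero _)
  | succ k ih =>
    rw [pow_succ, mul_nsmul', two_nsmul]
    exact ih ((inClass_add_self hP).add_self_ne_zero hd (Or.inl rfl))

theorem InClass.odd_nsmul {d : ℚ} (hd : d ≠ 0) {Q : (jacobian d).Point} (hQ : InClass d 13 Q)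
    (k : ℕ) : InClass d 13 ((2 * k + 1) • Q) := by
  have := hQ.add_double hd (k • Q)
  rwa [← two_nsmul, ← mul_nsmul', ← succ_nsmul'] at this

theorem InClass.nsmul_ne_zero {d : ℚ} (hd : d ≠ 0) {Q : (jacobian d).Point}
    (hQ : InClass d 13 Q) {n : ℕ} (hn : n ≠ 0) : n • Q ≠ 0 := by
  obtain ⟨k, m, hm, rfl⟩ := Nat.exists_eq_two_pow_mul_odd hn
  obtain ⟨j, rfl⟩ := hm
  rw [mul_nsmul']
  exact two_pow_nsmul_ne_zero hd k ((hQ.odd_nsmul hd j).add_self_ne_zero hd (Or.inr rfl))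

theorem InClass.infinite {d : ℚ} (hd : d ≠ 0) {Q : (jacobian d).Point} (hQ : InClass d 13 Q) :
    {P : (jacobian d).Point | InClass d 13 P}.Infinite := by
  refine Set.infinite_of_injective_forall_mem (f := fun k : ℕ => (2 * k + 1) • Q) ?_
    fun k => hQ.odd_nsmul hd k
  have hQ0 : ¬ IsOfFinAddOrder Q := by
    rw [isOfFinAddOrder_iff_nsmul_eq_zero]
    rintro ⟨n, hn, h⟩
    exact hQ.nsmul_ne_zero hd hn.ne' h
  intro k l hkl
  have := injective_nsmul_iff_not_isOfFinAddOrder.mpr hQ0 hkl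
  omega

/-- Infinitely many abscissae on the Jacobian lie in the square classes `(1, 13, 13)` as soon as
one does. -/
theorem infinite_setOf_hasClass {d x y : ℚ} (hd : d ≠ 0) (h : (jacobian d).Equation x y)
    (hx : HasClass d 13 x) : {x | HasClass d 13 x}.Infinite := by
  obtain ⟨h9, h13, h117⟩ := hx.ne_roots hd (Or.inr rfl)
  have hy : y ≠ 0 := by
    rintro rfl
    exact mul_ne_zero (mul_ne_zero h9 h13) h117 (by rw [← jacobian_equation_iff.mp h]; ring)
  have hinf := InClass.infinite hd ⟨x, y, jacobian_nonsingular h hy, rfl, hx⟩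
  intro hfin
  refine hinf ?_
  have key : ∀ x₀ : ℚ, {P : (jacobian d).Point |
      ∃ y₀, ∃ h₀ : (jacobian d).Nonsingular x₀ y₀, P = .some x₀ y₀ h₀}.Finite := by
    intro x₀
    by_cases hne : ∃ y₀, (jacobian d).Nonsingular x₀ y₀
    · obtain ⟨y₁, h₁⟩ := hne
      refine (Set.toFinite {.some x₀ y₁ h₁, -.some x₀ y₁ h₁}).subset ?_
      rintro _ ⟨y₀, h₀, rfl⟩
      exact Affine.Point.X_eq_iff.mp rfl
    · refine Set.finite_empty.subset ?_
      rintro _ ⟨y₀, h₀, -⟩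
      exact hne ⟨y₀, h₀⟩
  refine (hfin.biUnion fun x₀ _ => key x₀).subset ?_
  rintro P ⟨x₀, y₀, h₀, rfl, hx₀⟩
  exact Set.mem_biUnion hx₀ ⟨y₀, h₀, rfl⟩

/-! ### The two-covering -/

theorem quarticForm_ne_zero {X Z : ℚ} (h : X ≠ 0 ∨ Z ≠ 0) : quarticForm X Z ≠ 0 := by
  intro h0
  have hZ : Z = 0 := by
    rcases mul_eq_zero.mp h0 with h1 | h1
    · refine eq_zero_of_sq_eq_natCast_mul_sq (n := 13) (u := 2 * X - Z) (by norm_num) ?_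
      push_cast
      linear_combination 4 * h1
    · refine eq_zero_of_sq_eq_natCast_mul_sq (n := 13) (u := X + Z) (by norm_num) ?_
      push_cast
      linear_combination h1
  subst hZ
  have hX : X ^ 4 = 0 := by
    rw [← h0, quarticForm]
    ring
  exact h.elim (fun h => h (pow_eq_zero_iff (by norm_num) |>.mp hX)) fun h => h rfl

theorem Coords.Y_ne_zero {d : ℤ} (P : Coords d) : P.Y ≠ 0 := by
  intro h
  refine quarticForm_ne_zero P.ne_zero ?_
  rw [← P.equation, h]
  ring

/-- The abscissa of the image of a point of `H^d` under the two-covering `H^d → E^d`. -/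
def Coords.abscissa {d : ℤ} (P : Coords d) : ℚ :=
  9 * ((P.X ^ 2 - 6 * P.X * P.Z + 6 * P.Z ^ 2) / P.Y) ^ 2 - 9 * d

/-- With q₁, q₂, q₃ the three quadratics below, 13q₂² - 9q₁² = 4F and 13q₃² - q₁² = 12F. -/
theorem Coords.hasClass_abscissa {d : ℤ} (P : Coords d) : HasClass d 13 P.abscissa := by
  have hY := P.Y_ne_zero
  have hE := P.equation
  rw [quarticForm] at hE
  refine ⟨3 * ((P.X ^ 2 - 6 * P.X * P.Z + 6 * P.Z ^ 2) / P.Y),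
    (P.X ^ 2 - 4 * P.X * P.Z + 6 * P.Z ^ 2) / P.Y, 3 * (P.X ^ 2 - 6 * P.Z ^ 2) / P.Y, ?_, ?_, ?_⟩
  · rw [Coords.abscissa]
    ring
  · rw [Coords.abscissa]
    field_simp
    linear_combination 4 * hE
  · rw [Coords.abscissa]
    field_simp
    linear_combination 108 * hE

theorem HasClass.exists_equation {d x : ℚ} (h : HasClass d 13 x) :
    ∃ y, (jacobian d).Equation x y := by
  obtain ⟨r, s, t, hr, hs, ht⟩ := h
  refine ⟨13 * r * s * t, jacobian_equation_iff.mpr ?_⟩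
  rw [hr, hs, ht]
  ring

/-- The abscissa as a function on `H^d(ℚ)`. -/
def RationalPoint.abscissa {d : ℤ} : RationalPoint d → ℚ :=
  Quotient.lift Coords.abscissa <| by
    rintro P Q ⟨c, hc, hX, hY, hZ⟩
    have := P.Y_ne_zero
    simp only [Coords.abscissa, hX, hY, hZ]
    field_simp

/-- A point of the Jacobian in the square classes `(1, 13, 13)` lifts to `H^d`. -/
theorem HasClass.exists_abscissa_eq {d : ℤ} {x : ℚ} (hd : d ≠ 0) (h : HasClass d 13 x) :
    ∃ P : RationalPoint d, P.abscissa = x := by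
  obtain ⟨r, s, t, hr, hs, ht⟩ := h
  have hd' : (d : ℚ) ≠ 0 := Int.cast_ne_zero.mpr hd
  -- Here α, β, γ stand for X²/Y, XZ/Y, Z²/Y: they solve the linear system q₁ = r/3, q₂ = s, q₃ =
  -- t/3. The relation β² = αγ then recovers (X : Z).
  obtain ⟨α, hα⟩ : ∃ α, α = (t / 3 - 2 * (r / 3) + 3 * s) / 2 := ⟨_, rfl⟩
  obtain ⟨β, hβ⟩ : ∃ β, β = (s - r / 3) / 2 := ⟨_, rfl⟩
  obtain ⟨γ, hγ⟩ : ∃ γ, γ = (-(t / 3) - 2 * (r / 3) + 3 * s) / 12 := ⟨_, rfl⟩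
  have hβ2 : β ^ 2 = α * γ := by
    rw [hα, hβ, hγ]
    linear_combination -(1 / 216) * (2 * hr - 27 / 13 * hs + ht / 13)
  have hr3 : α - 6 * β + 6 * γ = r / 3 := by rw [hα, hβ, hγ]; ring
  have hnorm : (α - β - 3 * γ) * (α + 2 * β - 12 * γ) = d := by
    rw [hα, hβ, hγ]
    linear_combination (hs - ht) / 104
  have lift : ∀ X Z Y : ℚ, Y ≠ 0 → X ^ 2 = Y * α → X * Z = Y * β → Z ^ 2 = Y * γ →
      ∃ P : RationalPoint d, P.abscissa = x := by
    intro X Z Y hY hXX hXZ hZZ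
    refine ⟨Quotient.mk _ ⟨X, Y, Z, ?_, ?_⟩, ?_⟩
    · by_contra! h0
      obtain ⟨rfl, rfl⟩ := h0
      have h1 : α = 0 := by simpa [hY] using hXX.symm
      have h2 : β = 0 := by simpa [hY] using hXZ.symm
      have h3 : γ = 0 := by simpa [hY] using hZZ.symm
      rw [h1, h2, h3] at hnorm
      exact hd' (by rw [← hnorm]; ring)
    · rw [quarticForm, hXX, hXZ, mul_assoc 2, hXZ, hZZ, ← hnorm]
      ring
    · change 9 * ((X ^ 2 - 6 * X * Z + 6 * Z ^ 2) / Y) ^ 2 - 9 * (d : ℚ) = x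
      rw [mul_assoc 6, hXX, hXZ, hZZ]
      have : (Y * α - 6 * (Y * β) + 6 * (Y * γ)) / Y = r / 3 := by
        rw [← hr3]
        field_simp
      rw [this]
      linear_combination -hr
  by_cases hα0 : α = 0
  · have hβ0 : β = 0 := by
      rw [hα0, zero_mul] at hβ2
      exact pow_eq_zero_iff (two_ne_zero) |>.mp hβ2
    have hγ0 : γ ≠ 0 := by
      intro hγ0
      rw [hα0, hβ0, hγ0] at hnorm
      exact hd' (by rw [← hnorm]; ring)
    exact lift 0 γ γ hγ0 (by rw [hα0]; ring) (by rw [hβ0]; ring) (by ring)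
  · exact lift α β α hα0 (by ring) (by ring) hβ2

end QuarticTwist

theorem proposition3p4 (d : ℤ) (hd : Squarefree d)
    (h : Nonempty (QuarticTwist.RationalPoint d)) :
    Infinite (QuarticTwist.RationalPoint d) := by
  obtain ⟨⟨P⟩⟩ := h
  have hd0 : d ≠ 0 := hd.ne_zero
  obtain ⟨y, hy⟩ := P.hasClass_abscissa.exists_equation
  have hinf := QuarticTwist.infinite_setOf_hasClass (Int.cast_ne_zero.mpr hd0) hy
    P.hasClass_abscissa
  have hrange : (Set.range (QuarticTwist.RationalPoint.abscissa (d := d))).Infinite :=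
    hinf.mono fun x hx => hx.exists_abscissa_eq hd0
  refine not_finite_iff_infinite.mp fun _ => hrange (Set.finite_range _)
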